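/- **Setting.** There are $n$ buyers $N$ and $m$ sellers $M$, an edge set $E\subseteq N\times M$, and for every seller $j$ a monotone submodular function $f_j:2^{E_j}\to\mathbb R_+$ with $f_j(\emptyset)=0$, where $E_j$ is the set of edges at $j$ (and $E_i$ is the set of edges at a buyer $i$). Let $P=\{w\in\mathbb R_+^E: w(F)\le f_j(F)\ \forall j\in M,\,F\subseteq E_j\}$. Buyer $i$ has a private valuation $v_i>0$, reports a bid $v_i'>0$, and has a public budget $B_i\in[0,\infty]$; seller $j$ has a private valuation $\rho_j>0$ and reports a bid $\rho_j'>0$. The auctioneer also has one sample $\rho^s_j>0$ for each seller. An allocation is a triple $(w,p,r)$ of transactions $w\in\mathbb R_+^E$, payments $p\in\mathbb R_+^N$ and revenues $r\in\mathbb R_+^M$; it is feasible if $w\in P$ and $p_i\le B_i$ for all $i$. The utility of buyer $i$ is $v_i\sum_{ij\in E_i}w_{ij}-p_i$ if $p_i\le B_i$ and $-\infty$ otherwise; the utility of seller $j$ is $r_j-\rho_j\sum_{ij\in E_j}w_{ij}$. **Polyhedral Clinching Auction (PCA)** with price step $\varepsilon>0$, buyer bids $v'$ and seller bids $\rho'$.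 For every seller $j$ add a virtual buyer, adjacent to $j$ only, with bid $\rho'_j$ and infinite budget, and extend $f_j$ by $f_j(F)=f_j(E_j)$ (with the original $E_j$) whenever $F$ contains the edge of the virtual buyer. From here on, buyers, edges and $P$ refer to this extended market. Start with $w=0$, $p=0$, $r=0$, price clocks $c=0$ and demands $d=\infty$. While some demand is nonzero, perform the following iteration. 1. For every buyer $i$ in turn (original buyers first), let $i$ clinch a maximal vector $\xi_i$ among those $\xi\in\mathbb R_+^{E_i}$ with $P^i_{w,d}(\xi)=P^i_{w,d}(0)$, where $P^i_{w,d}(\xi)$ is the set of vectors $(y(E_k))_{k\neq i}$ with $y\ge 0$, $w+y\in P$, $y(E_k)\le d_k$ for all $k$, and $y|_{E_i}=\xi$. Then add $\xi_i$ to $w|_{E_i}$, add $c_i\xi_i(E_i)$ to $p_i$, add $c_i\xi_{ij}$ to $r_j$ for every $ij\in E_i$, and reset $d_i$. 2. Raise the clock $c_l$ of the next buyer $l$ in the cyclic order by $\varepsilon$ and reset $d_l$. To reset $d_i$ means to put $d_i=(B_i-p_i)/c_i$ if $c_i<v'_i$ (which is $\infty$ if $c_i=0$) and $d_i=0$ otherwise;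 for a virtual buyer, $v'_i$ is the bid of her seller. The choice among maximal vectors is made by any fixed rule that does not use the bids: it may depend only on the market, the budgets and the running data of the auction. The output consists of the transactions and payments of the original buyers and of the revenues $r_j$ minus the payment of the virtual buyer of $j$. **The mechanism $\mathbb M$.** Let $\tilde M=\{j\in M:\rho^s_j\ge\rho'_j\}$. Run PCA on the market restricted to the sellers in $\tilde M$, with buyer bids $v'$, budgets $B$ and seller bids $(\rho^s_j)_{j\in\tilde M}$. Keep its transactions (with $w_{ij}=0$ for $j\notin\tilde M$) and the payments of the buyers. The revenue of $j\in\tilde M$ is $\rho^s_j\,w(E_j)$, and that of $j\notin\tilde M$ is $0$. **Theorem.** For every $\varepsilon>0$ and every such selection rule, the loop in $\mathbb M$ terminates on every input, and $\mathbb M$ outputs a feasible allocation. Moreover, for all reported and sampled data as above: * (DSIC) for every buyer and every seller, and every valuation of that participant, replacing her bid by her valuation does not decrease her utility, whatever the other bids are; * (IR) every buyer and every seller who bids her valuation obtains nonnegative utility; * (WBB) $\sum_{i\in N}p_i\ge\sum_{j\in M}r_j$; * every seller is paid exactly her sample price per unit sold: $r_j=\rho^s_j\,w(E_j)$ for all $j\in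 M$. -/

import Mathlib

open scoped ENNReal

/-- A bipartite market with buyers `ι` and sellers `κ`: the edge set `E`, and for every seller `j`
a set function `f j`.  The set `E_j` of edges at seller `j` is identified with the set of
neighbours of `j`; only the values of `f j` on subsets of that set are ever used. -/
structure Market (ι κ : Type) where
  E : Finset (ι × κ)
  f : κ → Finset ι → ℝ

namespace Market

variable {ι κ : Type} [Fintype ι] [DecidableEq ι] [Fintype κ] [DecidableEq κ]

/-- The buyers adjacent to seller `j`, that is, the edge set `E_j`. -/
def nbrs (M : Market ι κ) (j : κ) : Finset ι := Finset.univ.filter fun i => (i, j) ∈ M.E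

/-- Every `f j` is a monotone submodular function on the subsets of `E_j`. -/
def IsMonotoneSubmodular (M : Market ι κ) : Prop :=
  ∀ j, M.f j ∅ = 0 ∧
    (∀ S T : Finset ι, S ⊆ T → T ⊆ M.nbrs j → M.f j S ≤ M.f j T) ∧
    (∀ S T : Finset ι, S ⊆ M.nbrs j → T ⊆ M.nbrs j →
      M.f j (S ∩ T) + M.f j (S ∪ T) ≤ M.f j S + M.f j T)

/-- The nonnegative vectors on the edge set, as functions on all pairs vanishing off `E`. -/
def edgeVectors (M : Market ι κ) : Set (ι → κ → ℝ) :=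
  {w | (∀ i j, 0 ≤ w i j) ∧ ∀ i j, (i, j) ∉ M.E → w i j = 0}

/-- The polymatroid `P = ⨁ P_j` of feasible transaction vectors. -/
def polymatroid (M : Market ι κ) : Set (ι → κ → ℝ) :=
  {w | w ∈ M.edgeVectors ∧ ∀ j, ∀ F ⊆ M.nbrs j, ∑ i ∈ F, w i j ≤ M.f j F}

/-- The market obtained by deleting all sellers outside `S`. -/
def restrict (M : Market ι κ) (S : Finset κ) : Market ι S where
  E := Finset.univ.filter fun e => (e.1, (e.2 : κ)) ∈ M.E
  f j := M.f j

/-- The market with a virtual buyer `Sum.inr j` for every seller `j`, adjacent to `j` only. -/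
def addVirtual (M : Market ι κ) : Market (ι ⊕ κ) κ where
  E := M.E.image (fun e => (Sum.inl e.1, e.2)) ∪ Finset.univ.image (fun j => (Sum.inr j, j))
  f j F := if Sum.inr j ∈ F then M.f j (M.nbrs j) else M.f j F.toLeft

/-- The remnant supply polytope `P_{w,d}`. -/
def remnantSupply (M : Market ι κ) (w : ι → κ → ℝ) (d : ι → ℝ≥0∞) : Set (ι → κ → ℝ) :=
  {y | y ∈ M.edgeVectors ∧ w + y ∈ M.polymatroid ∧ ∀ i, ENNReal.ofReal (∑ j, y i j) ≤ d i}

/-- `P^i_{w,d}(ξ)`: the possible future amounts of the buyers other than `i` if `i` takes `ξ`. -/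
def othersFuture (M : Market ι κ) (w : ι → κ → ℝ) (d : ι → ℝ≥0∞) (i : ι) (ξ : κ → ℝ) :
    Set ({k : ι // k ≠ i} → ℝ) :=
  {u | ∃ y ∈ M.remnantSupply w d, y i = ξ ∧ ∀ k : {k : ι // k ≠ i}, ∑ j, y k j = u k}

/-- The clinching polytope `P^i_{w,d}` of buyer `i`. -/
def clinchingPolytope (M : Market ι κ) (w : ι → κ → ℝ) (d : ι → ℝ≥0∞) (i : ι) : Set (κ → ℝ) :=
  {ξ | (∀ j, 0 ≤ ξ j) ∧ (∀ j, (i, j) ∉ M.E → ξ j = 0) ∧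
    M.othersFuture w d i ξ = M.othersFuture w d i 0}

end Market

/-- The running data of the clinching auction: transactions `w`, payments `p`, revenues `r`,
price clocks `c`, demands `d`, and the number `t` of completed iterations. -/
structure AuctionState (ι κ : Type) where
  w : ι → κ → ℝ
  p : ι → ℝ
  r : κ → ℝ
  c : ι → ℝ
  d : ι → ℝ≥0∞
  t : ℕ

/-- A method that picks the vector a buyer clinches.  It may use the market, the budgets and
the running data, but it has no access to the bids. -/
abbrev SelectionRule (ι κ : Type) : Type :=
  Market ι κ → (ι → ℝ≥0∞) → AuctionState ι κ → ι → κ → ℝ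

/-- The rule always picks a maximal vector of the clinching polytope (where there is one). -/
def SelectionRule.PicksMaximal {ι κ : Type} [Fintype ι] [DecidableEq ι] [Fintype κ]
    [DecidableEq κ] (sel : SelectionRule ι κ) : Prop :=
  ∀ (M : Market ι κ) (B : ι → ℝ≥0∞) (s : AuctionState ι κ) (i : ι),
    (∃ ξ, Maximal (· ∈ M.clinchingPolytope s.w s.d i) ξ) →
      Maximal (· ∈ M.clinchingPolytope s.w s.d i) (sel M B s i)

/-- The demand at price `c` of a buyer with budget `B` and bid `v'` who has already paid `p`;
it is infinite at price `0`. -/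
noncomputable def demand (B : ℝ≥0∞) (v' c p : ℝ) : ℝ≥0∞ :=
  if c < v' then
    if c = 0 then ⊤ else (B - ENNReal.ofReal p) / ENNReal.ofReal c
  else 0

namespace AuctionState

variable {ι κ : Type} [Fintype ι] [DecidableEq ι] [Fintype κ] [DecidableEq κ]

/-- The state before the first iteration. -/
def init : AuctionState ι κ where
  w _ _ := 0
  p _ := 0
  r _ := 0
  c _ := 0
  d _ := ⊤
  t := 0

/-- Buyer `i` clinches the selected vector at the unit price `c i`. -/
noncomputable def clinchOne (sel : SelectionRule ι κ) (M : Market ι κ) (B : ι → ℝ≥0∞) (v' : ι → ℝ)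
    (s : AuctionState ι κ) (i : ι) : AuctionState ι κ :=
  let ξ := sel M B s i
  let pay := s.p i + s.c i * ∑ j, ξ j
  { s with
    w := Function.update s.w i (s.w i + ξ)
    p := Function.update s.p i pay
    r := fun j => s.r j + s.c i * ξ j
    d := Function.update s.d i (demand (B i) (v' i) (s.c i) pay) }

/-- The clinching phase: the buyers clinch one after the other, in the given order. -/
noncomputable def clinching (sel : SelectionRule ι κ) (M : Market ι κ) (B : ι → ℝ≥0∞)
    (v' : ι → ℝ) (order : List ι) (s : AuctionState ι κ) : AuctionState ι κ :=
  order.foldl (clinchOne sel M B v') s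

/-- The price clock of buyer `l` goes up by `ε`, and the demand of `l` is updated. -/
noncomputable def raisePrice (ε : ℝ) (B : ι → ℝ≥0∞) (v' : ι → ℝ)
    (s : AuctionState ι κ) (l : ι) : AuctionState ι κ :=
  { s with
    c := Function.update s.c l (s.c l + ε)
    d := Function.update s.d l (demand (B l) (v' l) (s.c l + ε) (s.p l)) }

/-- One iteration: a clinching phase, and then a price increase for the next buyer in the cyclic
order.  (The value for an empty list of buyers is never used.) -/
noncomputable def step (ε : ℝ) (sel : SelectionRule ι κ) (M : Market ι κ) (B : ι → ℝ≥0∞)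
    (v' : ι → ℝ) (order : List ι) (s : AuctionState ι κ) : AuctionState ι κ :=
  let s' := clinching sel M B v' order s
  match order[s.t % order.length]? with
  | some l => { raisePrice ε B v' s' l with t := s.t + 1 }
  | none => { s' with t := s.t + 1 }

/-- The loop stops as soon as all demands are zero. -/
def Halted (s : AuctionState ι κ) : Prop := ∀ i, s.d i = 0

end AuctionState

/-- An allocation: transactions, payments of the buyers, revenues of the sellers. -/
structure Allocation (ι κ : Type) where
  w : ι → κ → ℝ
  p : ι → ℝ
  r : κ → ℝ

namespace PCA

variable {n : ℕ} {κ : Type} [Fintype κ] [LinearOrder κ]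

/-- The order of the buyers: first the original ones, and then the virtual ones. -/
def order (n : ℕ) (κ : Type) [Fintype κ] [LinearOrder κ] : List (Fin n ⊕ κ) :=
  (List.finRange n).map Sum.inl ++ ((Finset.univ : Finset κ).sort (· ≤ ·)).map Sum.inr

/-- The state of the clinching auction on the market with virtual buyers after `T` iterations.
The virtual buyer of seller `j` has the bid `ρ' j` and an infinite budget. -/
noncomputable def stateAt (ε : ℝ) (sel : SelectionRule (Fin n ⊕ κ) κ) (M : Market (Fin n) κ)
    (v' : Fin n → ℝ) (ρ' : κ → ℝ) (B : Fin n → ℝ≥0∞) (T : ℕ) : AuctionState (Fin n ⊕ κ) κ :=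
  (AuctionState.step ε sel M.addVirtual (Sum.elim B fun _ => ⊤) (Sum.elim v' ρ')
    (order n κ))^[T] AuctionState.init

/-- The auction halts after finitely many iterations. -/
def Terminates (ε : ℝ) (sel : SelectionRule (Fin n ⊕ κ) κ) (M : Market (Fin n) κ)
    (v' : Fin n → ℝ) (ρ' : κ → ℝ) (B : Fin n → ℝ≥0∞) : Prop :=
  ∃ T, (stateAt ε sel M v' ρ' B T).Halted

/-- The state in which the loop stops. -/
noncomputable def finalState (ε : ℝ) (sel : SelectionRule (Fin n ⊕ κ) κ) (M : Market (Fin n) κ)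
    (v' : Fin n → ℝ) (ρ' : κ → ℝ) (B : Fin n → ℝ≥0∞) : AuctionState (Fin n ⊕ κ) κ :=
  stateAt ε sel M v' ρ' B (sInf {T | (stateAt ε sel M v' ρ' B T).Halted})

/-- The Polyhedral Clinching Auction: the final state, with the transactions of the virtual
buyers cancelled. -/
noncomputable def run (ε : ℝ) (sel : SelectionRule (Fin n ⊕ κ) κ) (M : Market (Fin n) κ)
    (v' : Fin n → ℝ) (ρ' : κ → ℝ) (B : Fin n → ℝ≥0∞) : Allocation (Fin n) κ :=
  let s := finalState ε sel M v' ρ' B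
  { w := fun i => s.w (Sum.inl i)
    p := fun i => s.p (Sum.inl i)
    r := fun j => s.r j - s.p (Sum.inr j) }

end PCA

/-- The information available to the auctioneer in the single-sample setting: the market, the
bids `v'` and budgets `B` of the buyers, the bids `ρ'` of the sellers and the samples `ρs`. -/
structure Info (n m : ℕ) where
  market : Market (Fin n) (Fin m)
  v' : Fin n → ℝ
  B : Fin n → ℝ≥0∞
  ρ' : Fin m → ℝ
  ρs : Fin m → ℝ

/-- Bids and samples are positive, and the supply constraints are polymatroids. -/
def Info.Valid {n m : ℕ} (I : Info n m) : Prop :=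
  I.market.IsMonotoneSubmodular ∧ (∀ i, 0 < I.v' i) ∧ (∀ j, 0 < I.ρ' j) ∧ (∀ j, 0 < I.ρs j)

/-- The information after the bid of buyer `i` is replaced by `v`. -/
def Info.setBuyerBid {n m : ℕ} (I : Info n m) (i : Fin n) (v : ℝ) : Info n m :=
  { I with v' := Function.update I.v' i v }

/-- The information after the bid of seller `j` is replaced by `ρ`. -/
def Info.setSellerBid {n m : ℕ} (I : Info n m) (j : Fin m) (ρ : ℝ) : Info n m :=
  { I with ρ' := Function.update I.ρ' j ρ }

/-- A single-sample mechanism maps the information to an allocation. -/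
abbrev Mechanism (n m : ℕ) : Type := Info n m → Allocation (Fin n) (Fin m)

/-- The utility, under the allocation `A`, of buyer `i` with valuation `v`. -/
noncomputable def buyerUtility {n m : ℕ} (I : Info n m) (A : Allocation (Fin n) (Fin m))
    (i : Fin n) (v : ℝ) : EReal :=
  if ENNReal.ofReal (A.p i) ≤ I.B i then ((v * ∑ j, A.w i j - A.p i : ℝ) : EReal) else ⊥

/-- The amount of goods left at seller `j`. -/
noncomputable def unsold {n m : ℕ} (I : Info n m) (A : Allocation (Fin n) (Fin m)) (j : Fin m) :
    ℝ :=
  I.market.f j (I.market.nbrs j) - ∑ i ∈ I.market.nbrs j, A.w i j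

/-- The utility, under the allocation `A`, of seller `j` with valuation `ρ`: her revenue minus her
valuation of the goods sold. -/
noncomputable def sellerUtility {n m : ℕ} (I : Info n m) (A : Allocation (Fin n) (Fin m))
    (j : Fin m) (ρ : ℝ) : ℝ :=
  A.r j - ρ * (I.market.f j (I.market.nbrs j) - unsold I A j)

namespace Mechanism

variable {n m : ℕ}

/-- The output is always an allocation obeying the polymatroid and the budget constraints. -/
def IsFeasible (𝓜 : Mechanism n m) : Prop :=
  ∀ I : Info n m, I.Valid →
    (𝓜 I).w ∈ I.market.polymatroid ∧
    (∀ i, 0 ≤ (𝓜 I).p i ∧ ENNReal.ofReal ((𝓜 I).p i) ≤ I.B i) ∧ ∀ j, 0 ≤ (𝓜 I).r j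

/-- Truthful bidding is a dominant strategy of every buyer. -/
def DSICForBuyers (𝓜 : Mechanism n m) : Prop :=
  ∀ I : Info n m, I.Valid → ∀ (i : Fin n) (v : ℝ), 0 < v →
    buyerUtility I (𝓜 I) i v ≤ buyerUtility I (𝓜 (I.setBuyerBid i v)) i v

/-- Truthful bidding is a dominant strategy of every seller. -/
def DSICForSellers (𝓜 : Mechanism n m) : Prop :=
  ∀ I : Info n m, I.Valid → ∀ (j : Fin m) (ρ : ℝ), 0 < ρ →
    sellerUtility I (𝓜 I) j ρ ≤ sellerUtility I (𝓜 (I.setSellerBid j ρ)) j ρ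

/-- Individual rationality for buyers: a truthful buyer has nonnegative utility. -/
def IRForBuyers (𝓜 : Mechanism n m) : Prop :=
  ∀ I : Info n m, I.Valid → ∀ (i : Fin n) (v : ℝ), 0 < v →
    0 ≤ buyerUtility I (𝓜 (I.setBuyerBid i v)) i v

/-- Individual rationality for sellers: a truthful seller has nonnegative utility. -/
def IRForSellers (𝓜 : Mechanism n m) : Prop :=
  ∀ I : Info n m, I.Valid → ∀ (j : Fin m) (ρ : ℝ), 0 < ρ →
    0 ≤ sellerUtility I (𝓜 (I.setSellerBid j ρ)) j ρ

/-- Weak budget balance. -/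
def WBB (𝓜 : Mechanism n m) : Prop :=
  ∀ I : Info n m, I.Valid → ∑ j, (𝓜 I).r j ≤ ∑ i, (𝓜 I).p i

end Mechanism

/-- The participating sellers: those whose bid is at most their sample. -/
noncomputable def participants {n m : ℕ} (I : Info n m) : Finset (Fin m) :=
  Finset.univ.filter fun j => I.ρ' j ≤ I.ρs j

/-- The single-sample mechanism `𝕄`: the Polyhedral Clinching Auction is run on the market of the
participating sellers, with their samples in the place of their bids; transactions and payments
of the buyers are kept, and a participating seller receives her sample for every unit sold. -/
noncomputable def singleSampleMechanism {n m : ℕ} (ε : ℝ)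
    (sel : (S : Finset (Fin m)) → SelectionRule (Fin n ⊕ S) S) : Mechanism n m := fun I =>
  let S := participants I
  let A := PCA.run ε (sel S) (I.market.restrict S) I.v' (fun j : S => I.ρs j) I.B
  { w := fun i j => if h : j ∈ S then A.w i ⟨j, h⟩ else 0
    p := A.p
    r := fun j => if h : j ∈ S then I.ρs j * ∑ i, A.w i ⟨j, h⟩ else 0 }

/-! ### Compactness and feasibility of the clinching polytope -/

namespace Market

variable {ι κ : Type}

/-! Sellers face a posted price: a bid matters only through the test `ρ' j ≤ ρs j`, and the unit
price is the sample. A truthful seller who participates has valuation at most that price; a bid that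
reverses the outcome of the test yields either sales at a loss or no sales.

For a buyer, compare two runs that differ only in her bid, `a i ≤ b i`. The clocks follow a schedule
independent of the bids and the selection rule does not see them, so the runs coincide until her
clock reaches `a i`. From then on the low run gives her nothing, while the high run lets her clinch
only at prices in `[a i, b i)`: no benefit at valuation `a i`, no harm at valuation `b i`. This is
the invariant `Coupled`. The runs may halt at different times, but `iterate_of_halted` allows them
to be compared at a common late time.

Feasibility and budgets rest on `single_mem_remnantSupply`: a clinched vector is compatible with the
others taking nothing, so it respects the supply and the demand of the buyer.

Budget balance rests on the virtual buyers. Below her bid, a virtual buyer has infinite demand and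
could absorb all that is left at her seller, so nobody else can clinch there
(`eq_zero_of_insatiable`). Her clock never exceeds that of an original buyer at the start of an
iteration, hence every unit is bought at a price at least the sample (`sum_bid_mul_le_stateAt_p`).
-/

theorem isClosed_edgeVectors (M : Market ι κ) : IsClosed M.edgeVectors := by
  simp only [edgeVectors, Set.ofPred_and, Set.ofPred_forall]
  refine IsClosed.inter ?_ ?_
  · exact isClosed_iInter fun i => isClosed_iInter fun j =>
      isClosed_le continuous_const (by fun_prop)
  · exact isClosed_iInter fun i => isClosed_iInter fun j => isClosed_iInter fun _ =>
      isClosed_eq (by fun_prop) continuous_const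

variable [Fintype ι] [DecidableEq ι] [DecidableEq κ]

theorem IsMonotoneSubmodular.nonneg {M : Market ι κ} (h : M.IsMonotoneSubmodular) {j : κ}
    {F : Finset ι} (hF : F ⊆ M.nbrs j) : 0 ≤ M.f j F := by
  have := (h j).2.1 ∅ F (Finset.empty_subset _) hF
  rwa [(h j).1] at this

theorem mem_nbrs {M : Market ι κ} {i : ι} {j : κ} : i ∈ M.nbrs j ↔ (i, j) ∈ M.E := by
  simp [nbrs]

theorem isClosed_polymatroid (M : Market ι κ) : IsClosed M.polymatroid := by
  simp only [polymatroid, Set.ofPred_and, Set.ofPred_forall]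
  refine IsClosed.inter M.isClosed_edgeVectors ?_
  exact isClosed_iInter fun j => isClosed_iInter fun F => isClosed_iInter fun _ =>
    isClosed_le (by fun_prop) continuous_const

variable [Fintype κ]

theorem zero_mem_remnantSupply {M : Market ι κ} {w : ι → κ → ℝ} (hw : w ∈ M.polymatroid)
    (d : ι → ℝ≥0∞) : 0 ∈ M.remnantSupply w d :=
  ⟨⟨fun _ _ => le_rfl, fun _ _ _ => rfl⟩, by simpa using hw, fun i => by simp⟩

theorem isCompact_remnantSupply (M : Market ι κ) (w : ι → κ → ℝ) (d : ι → ℝ≥0∞) :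
    IsCompact (M.remnantSupply w d) := by
  have hclosed : IsClosed (M.remnantSupply w d) := by
    simp only [remnantSupply, Set.ofPred_and, Set.ofPred_forall]
    refine IsClosed.inter M.isClosed_edgeVectors (IsClosed.inter ?_ ?_)
    · exact M.isClosed_polymatroid.preimage (continuous_const.add continuous_id)
    · exact isClosed_iInter fun i =>
        isClosed_le (ENNReal.continuous_ofReal.comp (by fun_prop)) continuous_const
  -- The polymatroid constraint of the singleton `{i}` bounds each coordinate on an edge.
  refine (isCompact_Icc (a := (0 : ι → κ → ℝ))
    (b := fun i j => if (i, j) ∈ M.E then M.f j {i} - w i j else 0)).of_isClosed_subset hclosed ?_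
  rintro y ⟨⟨h0, hE⟩, ⟨-, hP⟩, -⟩
  refine ⟨fun i j => h0 i j, fun i j => ?_⟩
  by_cases h : (i, j) ∈ M.E
  · have := hP j {i} (by simpa [mem_nbrs] using h)
    simp only [Finset.sum_singleton, Pi.add_apply] at this
    simp only [h, if_true]
    linarith
  · simp [h, hE i j h]

theorem mem_othersFuture_zero {M : Market ι κ} {w : ι → κ → ℝ} (hw : w ∈ M.polymatroid)
    (d : ι → ℝ≥0∞) (i : ι) : 0 ∈ M.othersFuture w d i 0 :=
  ⟨0, zero_mem_remnantSupply hw d, rfl, fun k => by simp⟩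

/-- All constraints are upper bounds on sums of nonnegative terms, so they survive lowering the
coordinates of one buyer to zero. -/
theorem update_mem_remnantSupply {M : Market ι κ} {w y : ι → κ → ℝ} {d : ι → ℝ≥0∞}
    (hy : y ∈ M.remnantSupply w d) (hw : w ∈ M.edgeVectors) (i : ι) :
    Function.update y i 0 ∈ M.remnantSupply w d := by
  obtain ⟨⟨h0, hE⟩, ⟨⟨-, hE'⟩, hP⟩, hd⟩ := hy
  have hle : ∀ k j, Function.update y i 0 k j ≤ y k j := by
    intro k j
    by_cases hk : k = i
    · subst hk; simpa using h0 k j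
    · simp [hk]
  have hnn : ∀ k j, 0 ≤ Function.update y i 0 k j := by
    intro k j
    by_cases hk : k = i
    · subst hk; simp
    · simpa [hk] using h0 k j
  have hz : ∀ k j, (k, j) ∉ M.E → Function.update y i 0 k j = 0 := fun k j h =>
    le_antisymm ((hle k j).trans (hE k j h).le) (hnn k j)
  refine ⟨⟨hnn, hz⟩, ⟨⟨fun k j => add_nonneg (hw.1 k j) (hnn k j), fun k j h => ?_⟩,
    fun j F hF => ?_⟩, fun k => ?_⟩
  · simp [hw.2 k j h, hz k j h]
  · exact (Finset.sum_le_sum fun k _ => add_le_add le_rfl (hle k j)).trans (hP j F hF)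
  · exact (ENNReal.ofReal_le_ofReal (Finset.sum_le_sum fun j _ => hle k j)).trans (hd k)

/-- One half of the equality that defines clinching is automatic; only the reverse inclusion
constrains `ξ`. -/
theorem othersFuture_subset_zero {M : Market ι κ} {w : ι → κ → ℝ} (hw : w ∈ M.edgeVectors)
    (d : ι → ℝ≥0∞) (i : ι) (ξ : κ → ℝ) : M.othersFuture w d i ξ ⊆ M.othersFuture w d i 0 := by
  rintro u ⟨y, hy, -, hu⟩
  refine ⟨_, update_mem_remnantSupply hy hw i, by simp, fun k => ?_⟩
  rw [Function.update_of_ne k.2]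
  exact hu k

/-- For each future `u` of the others, the `ξ` compatible with `u` form a projection of a compact
set. The clinching polytope is the intersection of these slices over all `u` that are possible at `ξ
= 0`. -/
theorem isCompact_clinchingPolytope {M : Market ι κ} {w : ι → κ → ℝ} (hw : w ∈ M.polymatroid)
    (d : ι → ℝ≥0∞) (i : ι) : IsCompact (M.clinchingPolytope w d i) := by
  set slice : ({k : ι // k ≠ i} → ℝ) → Set (κ → ℝ) := fun u =>
    (fun y : ι → κ → ℝ => y i) ''
      (M.remnantSupply w d ∩ {y | ∀ k : {k : ι // k ≠ i}, ∑ j, y k j = u k}) with hslice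
  have hcomp : ∀ u, IsCompact (slice u) := by
    intro u
    refine ((M.isCompact_remnantSupply w d).inter_right ?_).image (by fun_prop)
    simp only [Set.ofPred_forall]
    exact isClosed_iInter fun k => isClosed_eq (by fun_prop) continuous_const
  have heq : M.clinchingPolytope w d i = slice 0 ∩ ⋂ u ∈ M.othersFuture w d i 0, slice u := by
    ext ξ
    have key : (∀ u ∈ M.othersFuture w d i 0, ξ ∈ slice u) ↔
        M.othersFuture w d i 0 ⊆ M.othersFuture w d i ξ := by
      refine forall₂_congr fun u _ => ?_
      exact ⟨fun ⟨y, ⟨h1, h2⟩, h3⟩ => ⟨y, h1, h3, h2⟩, fun ⟨y, h1, h3, h2⟩ => ⟨y, ⟨h1, h2⟩, h3⟩⟩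
    simp only [Set.mem_inter_iff, Set.mem_iInter, key]
    constructor
    · rintro ⟨-, -, h⟩
      exact ⟨key.2 h.ge 0 (mem_othersFuture_zero hw d i), h.ge⟩
    · rintro ⟨⟨y, ⟨hy, -⟩, rfl⟩, h⟩
      exact ⟨fun j => hy.1.1 i j, fun j => hy.1.2 i j,
        (othersFuture_subset_zero hw.1 d i _).antisymm h⟩
  rw [heq]
  exact (hcomp 0).inter_right (isClosed_biInter fun u _ => (hcomp u).isClosed)

/-- A maximizer of the coordinate sum is maximal in the product order. This discharges the premise
of `PicksMaximal`. -/
theorem exists_maximal_clinchingPolytope {M : Market ι κ} {w : ι → κ → ℝ}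
    (hw : w ∈ M.polymatroid) (d : ι → ℝ≥0∞) (i : ι) :
    ∃ ξ, Maximal (· ∈ M.clinchingPolytope w d i) ξ := by
  obtain ⟨ξ, hξ, hmax⟩ := (isCompact_clinchingPolytope hw d i).exists_isMaxOn
    ⟨0, fun _ => le_rfl, fun _ _ => rfl, rfl⟩
    (f := fun ξ : κ → ℝ => ∑ j, ξ j) (by fun_prop)
  refine ⟨ξ, hξ, fun η hη hle => ?_⟩
  have heq := (Finset.sum_eq_sum_iff_of_le fun j _ => hle j).1
    ((Finset.sum_le_sum fun j _ => hle j).antisymm (hmax hη))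
  exact fun j => (heq j (Finset.mem_univ j)).ge

/-- The future in which all others get zero must remain possible after clinching `ξ`; by
nonnegativity its witness vanishes outside row `i`. -/
theorem single_mem_remnantSupply {M : Market ι κ} {w : ι → κ → ℝ} (hw : w ∈ M.polymatroid)
    {d : ι → ℝ≥0∞} {i : ι} {ξ : κ → ℝ} (hξ : ξ ∈ M.clinchingPolytope w d i) :
    Function.update (0 : ι → κ → ℝ) i ξ ∈ M.remnantSupply w d := by
  obtain ⟨y, hy, rfl, hu⟩ := hξ.2.2.ge (mem_othersFuture_zero hw d i)
  convert hy
  funext k j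
  by_cases hk : k = i
  · subst hk; simp
  · have := (Finset.sum_eq_zero_iff_of_nonneg fun j _ => hy.1.1 k j).1 (hu ⟨k, hk⟩)
    simp [hk, this j (Finset.mem_univ j)]

theorem update_add_mem_polymatroid {M : Market ι κ} {w : ι → κ → ℝ} (hw : w ∈ M.polymatroid)
    {d : ι → ℝ≥0∞} {i : ι} {ξ : κ → ℝ} (hξ : ξ ∈ M.clinchingPolytope w d i) :
    Function.update w i (w i + ξ) ∈ M.polymatroid := by
  convert (single_mem_remnantSupply hw hξ).2.1 using 1
  funext k
  by_cases hk : k = i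
  · subst hk; simp
  · simp [hk]

theorem ofReal_sum_le_demand {M : Market ι κ} {w : ι → κ → ℝ} (hw : w ∈ M.polymatroid)
    {d : ι → ℝ≥0∞} {i : ι} {ξ : κ → ℝ} (hξ : ξ ∈ M.clinchingPolytope w d i) :
    ENNReal.ofReal (∑ j, ξ j) ≤ d i := by
  simpa using (single_mem_remnantSupply hw hξ).2.2 i

theorem eq_zero_of_demand_eq_zero {M : Market ι κ} {w : ι → κ → ℝ} (hw : w ∈ M.polymatroid)
    {d : ι → ℝ≥0∞} {i : ι} {ξ : κ → ℝ} (hξ : ξ ∈ M.clinchingPolytope w d i) (hd : d i = 0) :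
    ξ = 0 := by
  have h := ofReal_sum_le_demand hw hξ
  rw [hd, nonpos_iff_eq_zero, ENNReal.ofReal_eq_zero] at h
  have := (Finset.sum_eq_zero_iff_of_nonneg fun j _ => hξ.1 j).1
    (h.antisymm (Finset.sum_nonneg fun j _ => hξ.1 j))
  exact funext fun j => this j (Finset.mem_univ j)

/-- A buyer cannot clinch from seller `j` while an insatiable buyer `l` is able to take all that
is left at `j`. -/
theorem eq_zero_of_insatiable {M : Market ι κ} {w : ι → κ → ℝ} (hw : w ∈ M.polymatroid)
    {d : ι → ℝ≥0∞} {i l : ι} {ξ : κ → ℝ} (hξ : ξ ∈ M.clinchingPolytope w d i) {j : κ}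
    (hil : l ≠ i) (hl : (l, j) ∈ M.E) (honly : ∀ j', (l, j') ∈ M.E → j' = j)
    (hf : ∀ F ⊆ M.nbrs j, l ∈ F → M.f j F = M.f j (M.nbrs j)) (hd : d l = ⊤) : ξ j = 0 := by
  by_cases hi : (i, j) ∈ M.E
  swap
  · exact hξ.2.1 j hi
  set R : ℝ := M.f j (M.nbrs j) - ∑ k ∈ M.nbrs j, w k j with hR
  have hR0 : 0 ≤ R := sub_nonneg.2 (hw.2 j _ subset_rfl)
  -- In the future `z`, buyer `l` takes the whole remainder `R` of seller `j`.
  set z : ι → κ → ℝ := fun k j' => if k = l ∧ j' = j then R else 0 with hz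
  have hz0 : ∀ k j', 0 ≤ z k j' := fun k j' => by simp only [hz]; split_ifs <;> simp [hR0]
  have hzE : ∀ k j', (k, j') ∉ M.E → z k j' = 0 := by
    intro k j' h
    simp only [hz]
    rw [if_neg]
    rintro ⟨rfl, rfl⟩
    exact h hl
  have hzmem : z ∈ M.remnantSupply w d := by
    refine ⟨⟨hz0, hzE⟩, ⟨⟨fun k j' => add_nonneg (hw.1.1 k j') (hz0 k j'), fun k j' h => ?_⟩,
      fun j' F hF => ?_⟩, fun k => ?_⟩
    · simp [hw.1.2 k j' h, hzE k j' h]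
    · simp only [Pi.add_apply, Finset.sum_add_distrib]
      by_cases hj : j' = j
      swap
      · simpa [hz, hj] using hw.2 j' F hF
      subst hj
      -- If `l ∈ F`, the bound for `F` equals the one for the full neighbourhood, whose slack is
      -- exactly `R`.
      by_cases hlF : l ∈ F
      · have h1 : ∑ k ∈ F, w k j' ≤ ∑ k ∈ M.nbrs j', w k j' :=
          Finset.sum_le_sum_of_subset_of_nonneg hF fun k _ _ => hw.1.1 k j'
        have h2 : ∑ k ∈ F, z k j' = R := by simp [hz, hlF]
        rw [h2, hf F hF hlF]
        linarith
      · have h2 : ∑ k ∈ F, z k j' = 0 := Finset.sum_eq_zero fun k hk => by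
          simp only [hz]
          rw [if_neg]
          rintro ⟨rfl, -⟩
          exact hlF hk
        rw [h2, add_zero]
        exact hw.2 j' F hF
    · by_cases hk : k = l
      · subst hk; simp [hd]
      · simp [hz, hk]
  have hzfut : (fun k : {k : ι // k ≠ i} => ∑ j', z k j') ∈ M.othersFuture w d i 0 :=
    ⟨z, hzmem, by funext j'; simp [hz, hil.symm], fun k => rfl⟩
  -- The same totals must be possible alongside `ξ`. As `j` is the only seller of `l`, she still
  -- takes `R` there, which leaves nothing for `i`.
  obtain ⟨y, hy, hyi, hsum⟩ := hξ.2.2.ge hzfut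
  have hyl : y l j = R := by
    have h := hsum ⟨l, hil⟩
    rw [Finset.sum_eq_single j (fun j' _ hj' => hy.1.2 l j' fun h => hj' (honly j' h))
      (by simp)] at h
    simpa [hz] using h
  have hP := hy.2.1.2 j _ subset_rfl
  simp only [Pi.add_apply, Finset.sum_add_distrib] at hP
  have hpair : y l j + y i j ≤ ∑ k ∈ M.nbrs j, y k j := by
    rw [← Finset.sum_pair hil (f := fun k => y k j)]
    refine Finset.sum_le_sum_of_subset_of_nonneg ?_ fun k _ _ => hy.1.1 k j
    intro k hk
    rcases Finset.mem_insert.1 hk with rfl | hk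
    · exact mem_nbrs.2 hl
    · rw [Finset.mem_singleton.1 hk]; exact mem_nbrs.2 hi
  have hξj : y i j = ξ j := by rw [hyi]
  linarith [hξ.1 j]

end Market

/-! ### Demands, and the arithmetic of the cyclic clock -/

theorem demand_eq_zero {B : ℝ≥0∞} {v' c p : ℝ} (h : v' ≤ c) : demand B v' c p = 0 := by
  simp [demand, h.not_gt]

theorem demand_congr {B : ℝ≥0∞} {a b c p : ℝ} (ha : c < a) (hb : c < b) :
    demand B a c p = demand B b c p := by
  simp [demand, ha, hb]

theorem demand_top {v' c p : ℝ} (h : c < v') : demand ⊤ v' c p = ⊤ := by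
  simp only [demand, h, if_true]
  split_ifs
  · rfl
  · rw [ENNReal.top_sub ENNReal.ofReal_ne_top, ENNReal.top_div_of_ne_top ENNReal.ofReal_ne_top]

/-- A demand that has dropped to zero stays zero when the price goes up. -/
theorem demand_eq_zero_of_le {B : ℝ≥0∞} {v' c c' p : ℝ} (hc : 0 ≤ c) (hcc : c ≤ c')
    (h : demand B v' c p = 0) : demand B v' c' p = 0 := by
  by_cases hv : c < v'
  swap
  · exact demand_eq_zero ((not_lt.1 hv).trans hcc)
  simp only [demand, hv, if_true] at h
  split_ifs at h with h0
  · exact absurd h ENNReal.top_ne_zero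
  have hB : B - ENNReal.ofReal p = 0 := by
    rcases ENNReal.div_eq_zero_iff.1 h with h | h
    · exact h
    · exact absurd h ENNReal.ofReal_ne_top
  have : c' ≠ 0 := ((hc.lt_of_ne' h0).trans_le hcc).ne'
  simp [demand, hB, this]

/-- A purchase within the demand does not exceed the budget. -/
theorem ofReal_pay_le_budget {B : ℝ≥0∞} {v' c p x : ℝ} (hc : 0 ≤ c) (hp : 0 ≤ p) (hx : 0 ≤ x)
    (hpB : ENNReal.ofReal p ≤ B) (hd : ENNReal.ofReal x ≤ demand B v' c p) :
    ENNReal.ofReal (p + c * x) ≤ B := by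
  by_cases hv : c < v'
  swap
  · rw [demand_eq_zero (not_lt.1 hv), nonpos_iff_eq_zero, ENNReal.ofReal_eq_zero] at hd
    rw [hd.antisymm hx]
    simpa using hpB
  by_cases h0 : c = 0
  · simpa [h0] using hpB
  simp only [demand, hv, h0, if_true, if_false] at hd
  rw [ENNReal.ofReal_add hp (mul_nonneg hc hx), ENNReal.ofReal_mul hc]
  have := ENNReal.mul_le_of_le_div' hd
  exact (add_le_add le_rfl this).trans (add_tsub_cancel_of_le hpB).le

/-- Tells when the quotient `(T + (L - 1 - k)) / L` jumps at the next `T`: precisely when it is the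
turn of position `k`. -/
theorem dvd_add_sub_add_one_iff_mod_eq (T : ℕ) {L k : ℕ} (hk : k < L) :
    L ∣ T + (L - 1 - k) + 1 ↔ T % L = k := by
  rw [show T + (L - 1 - k) + 1 = T + (L - k) by omega, Nat.dvd_iff_mod_eq_zero, Nat.add_mod]
  have ha : T % L < L := Nat.mod_lt _ (by omega)
  generalize T % L = a at *
  rcases Nat.eq_zero_or_pos k with rfl | hk0
  · rw [Nat.sub_zero, Nat.mod_self, Nat.add_zero, Nat.mod_eq_of_lt ha]
  · rw [Nat.mod_eq_of_lt (a := L - k) (by omega)]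
    rcases lt_or_ge (a + (L - k)) L with h | h
    · rw [Nat.mod_eq_of_lt h]; omega
    · rw [Nat.mod_eq_sub_mod h, Nat.mod_eq_of_lt (by omega)]; omega

/-! ### Invariants of a single run, and the clock schedule -/

namespace AuctionState

variable {ι κ : Type} [Fintype ι] [DecidableEq ι] [Fintype κ] [DecidableEq κ]

theorem sel_mem {sel : SelectionRule ι κ} (hsel : sel.PicksMaximal) {M : Market ι κ}
    {s : AuctionState ι κ} (hw : s.w ∈ M.polymatroid) (B : ι → ℝ≥0∞) (i : ι) :
    sel M B s i ∈ M.clinchingPolytope s.w s.d i :=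
  (hsel M B s i (Market.exists_maximal_clinchingPolytope hw s.d i)).1

omit [DecidableEq κ] [Fintype ι] in
theorem clinching_induction {sel : SelectionRule ι κ} {M : Market ι κ} {B : ι → ℝ≥0∞}
    {v' : ι → ℝ} {P : AuctionState ι κ → Prop} (h : ∀ s l, P s → P (clinchOne sel M B v' s l))
    (order : List ι) (s : AuctionState ι κ) (hs : P s) : P (clinching sel M B v' order s) := by
  induction order generalizing s with
  | nil => exact hs
  | cons l order ih => exact ih _ (h s l hs)

omit [DecidableEq κ] [Fintype ι] in
theorem step_induction {ε : ℝ} {sel : SelectionRule ι κ} {M : Market ι κ} {B : ι → ℝ≥0∞}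
    {v' : ι → ℝ} {P : AuctionState ι κ → Prop} (h : ∀ s l, P s → P (clinchOne sel M B v' s l))
    (hr : ∀ s l, P s → P (raisePrice ε B v' s l)) (ht : ∀ s t, P s → P { s with t := t })
    (order : List ι) (s : AuctionState ι κ) (hs : P s) : P (step ε sel M B v' order s) := by
  have hc := clinching_induction h order s hs
  unfold step
  dsimp only
  split
  · exact ht _ _ (hr _ _ hc)
  · exact ht _ _ hc

/-- The invariants of the auction: feasibility, and demands that fit the other data. -/
structure Consistent (M : Market ι κ) (B : ι → ℝ≥0∞) (v' : ι → ℝ) (s : AuctionState ι κ) :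
    Prop where
  mem : s.w ∈ M.polymatroid
  c_nonneg : ∀ i, 0 ≤ s.c i
  p_nonneg : ∀ i, 0 ≤ s.p i
  p_le : ∀ i, ENNReal.ofReal (s.p i) ≤ B i
  d_eq : ∀ i, s.d i = demand (B i) (v' i) (s.c i) (s.p i)

omit [Fintype κ] in
theorem Consistent.init {M : Market ι κ} (hM : ∀ j, ∀ F ⊆ M.nbrs j, 0 ≤ M.f j F)
    (B : ι → ℝ≥0∞) {v' : ι → ℝ} (hv : ∀ i, 0 < v' i) : Consistent M B v' AuctionState.init where
  mem := ⟨⟨fun _ _ => le_rfl, fun _ _ _ => rfl⟩, fun j F hF => by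
    simpa [AuctionState.init] using hM j F hF⟩
  c_nonneg _ := le_rfl
  p_nonneg _ := le_rfl
  p_le i := by simp [AuctionState.init]
  d_eq i := by simp [AuctionState.init, demand, hv]

theorem Consistent.sel_eq_zero_of_demand {sel : SelectionRule ι κ} (hsel : sel.PicksMaximal)
    {M : Market ι κ} {B : ι → ℝ≥0∞} {v' : ι → ℝ} {s : AuctionState ι κ}
    (hs : Consistent M B v' s) {i : ι} (hd : s.d i = 0) : sel M B s i = 0 :=
  Market.eq_zero_of_demand_eq_zero hs.mem (sel_mem hsel hs.mem B i) hd

theorem Consistent.sel_eq_zero {sel : SelectionRule ι κ} (hsel : sel.PicksMaximal)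
    {M : Market ι κ} {B : ι → ℝ≥0∞} {v' : ι → ℝ} {s : AuctionState ι κ}
    (hs : Consistent M B v' s) {i : ι} (hi : v' i ≤ s.c i) : sel M B s i = 0 :=
  hs.sel_eq_zero_of_demand hsel ((hs.d_eq i).trans (demand_eq_zero hi))

theorem Consistent.clinchOne {sel : SelectionRule ι κ} (hsel : sel.PicksMaximal)
    {M : Market ι κ} {B : ι → ℝ≥0∞} {v' : ι → ℝ} {s : AuctionState ι κ}
    (hs : Consistent M B v' s) (i : ι) : Consistent M B v' (clinchOne sel M B v' s i) := by
  have hξ := sel_mem hsel hs.mem B i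
  have hξ0 : 0 ≤ ∑ j, sel M B s i j := Finset.sum_nonneg fun j _ => hξ.1 j
  refine ⟨Market.update_add_mem_polymatroid hs.mem hξ, hs.c_nonneg, fun k => ?_, fun k => ?_,
    fun k => ?_⟩ <;> by_cases hk : k = i
  · subst hk
    simpa [AuctionState.clinchOne] using
      add_nonneg (hs.p_nonneg k) (mul_nonneg (hs.c_nonneg k) hξ0)
  · simpa [AuctionState.clinchOne, hk] using hs.p_nonneg k
  · subst hk
    have hd := Market.ofReal_sum_le_demand hs.mem hξ
    rw [hs.d_eq] at hd
    simpa [AuctionState.clinchOne] using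
      ofReal_pay_le_budget (hs.c_nonneg k) (hs.p_nonneg k) hξ0 (hs.p_le k) hd
  · simpa [AuctionState.clinchOne, hk] using hs.p_le k
  · subst hk
    simp [AuctionState.clinchOne]
  · simpa [AuctionState.clinchOne, hk] using hs.d_eq k

omit [Fintype κ] in
theorem Consistent.raisePrice {ε : ℝ} (hε : 0 ≤ ε) {M : Market ι κ} {B : ι → ℝ≥0∞}
    {v' : ι → ℝ} {s : AuctionState ι κ} (hs : Consistent M B v' s) (l : ι) :
    Consistent M B v' (raisePrice ε B v' s l) := by
  refine ⟨hs.mem, fun k => ?_, hs.p_nonneg, hs.p_le, fun k => ?_⟩ <;> by_cases hk : k = l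
  · subst hk
    simpa [AuctionState.raisePrice] using add_nonneg (hs.c_nonneg k) hε
  · simpa [AuctionState.raisePrice, hk] using hs.c_nonneg k
  · subst hk
    simp [AuctionState.raisePrice]
  · simpa [AuctionState.raisePrice, hk] using hs.d_eq k

theorem Consistent.step {ε : ℝ} (hε : 0 ≤ ε) {sel : SelectionRule ι κ} (hsel : sel.PicksMaximal)
    {M : Market ι κ} {B : ι → ℝ≥0∞} {v' : ι → ℝ} (order : List ι) {s : AuctionState ι κ}
    (hs : Consistent M B v' s) : Consistent M B v' (step ε sel M B v' order s) :=
  step_induction (P := Consistent M B v') (fun _ l h => h.clinchOne hsel l)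
    (fun _ l h => h.raisePrice hε l) (fun _ _ h => ⟨h.1, h.2, h.3, h.4, h.5⟩) order s hs

theorem Consistent.iterate {ε : ℝ} (hε : 0 ≤ ε) {sel : SelectionRule ι κ}
    (hsel : sel.PicksMaximal) {M : Market ι κ} {B : ι → ℝ≥0∞} {v' : ι → ℝ} (order : List ι)
    {s : AuctionState ι κ} (hs : Consistent M B v' s) (T : ℕ) :
    Consistent M B v' ((AuctionState.step ε sel M B v' order)^[T] s) := by
  induction T with
  | zero => exact hs
  | succ T ih => rw [Function.iterate_succ_apply']; exact ih.step hε hsel order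

/-- Nothing but clocks and revenues changes after the auction has halted. -/
theorem Consistent.step_of_halted {ε : ℝ} (hε : 0 ≤ ε) {sel : SelectionRule ι κ}
    (hsel : sel.PicksMaximal) {M : Market ι κ} {B : ι → ℝ≥0∞} {v' : ι → ℝ} (order : List ι)
    {s : AuctionState ι κ} (hs : Consistent M B v' s) (hh : s.Halted) :
    (AuctionState.step ε sel M B v' order s).Halted ∧
      (AuctionState.step ε sel M B v' order s).w = s.w ∧
      (AuctionState.step ε sel M B v' order s).p = s.p := by
  refine (step_induction (P := fun s' => Consistent M B v' s' ∧ s'.Halted ∧ s'.w = s.w ∧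
    s'.p = s.p) ?_ ?_ ?_ order s ⟨hs, hh, rfl, rfl⟩).2
  · rintro s' i ⟨hc, hh', hw, hp⟩
    have h0 := hc.sel_eq_zero_of_demand hsel (hh' i)
    refine ⟨hc.clinchOne hsel i, fun k => ?_, ?_, ?_⟩
    · by_cases hk : k = i
      · subst hk
        simpa [AuctionState.clinchOne, h0] using (hc.d_eq k).symm.trans (hh' k)
      · simpa [AuctionState.clinchOne, hk] using hh' k
    · simp [AuctionState.clinchOne, h0, hw]
    · simp [AuctionState.clinchOne, h0, hp]
  · rintro s' l ⟨hc, hh', hw, hp⟩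
    refine ⟨hc.raisePrice hε l, fun k => ?_, hw, hp⟩
    by_cases hk : k = l
    · subst hk
      simpa [AuctionState.raisePrice] using demand_eq_zero_of_le (hc.c_nonneg k)
        (le_add_of_nonneg_right hε) ((hc.d_eq k).symm.trans (hh' k))
    · simpa [AuctionState.raisePrice, hk] using hh' k
  · rintro s' t ⟨hc, h⟩
    exact ⟨⟨hc.1, hc.2, hc.3, hc.4, hc.5⟩, h⟩

/-- Lets outcomes be read off at any later time, so that runs with different halting times can be
compared. -/
theorem Consistent.iterate_of_halted {ε : ℝ} (hε : 0 ≤ ε) {sel : SelectionRule ι κ}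
    (hsel : sel.PicksMaximal) {M : Market ι κ} {B : ι → ℝ≥0∞} {v' : ι → ℝ} (order : List ι)
    {s : AuctionState ι κ} (hs : Consistent M B v' s) (hh : s.Halted) (T : ℕ) :
    ((AuctionState.step ε sel M B v' order)^[T] s).Halted ∧
      ((AuctionState.step ε sel M B v' order)^[T] s).w = s.w ∧
      ((AuctionState.step ε sel M B v' order)^[T] s).p = s.p := by
  induction T with
  | zero => exact ⟨hh, rfl, rfl⟩
  | succ T ih =>
    rw [Function.iterate_succ_apply']
    have h := (hs.iterate hε hsel order T).step_of_halted hε hsel order ih.1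
    exact ⟨h.1, h.2.1.trans ih.2.1, h.2.2.trans ih.2.2⟩

omit [DecidableEq κ] [Fintype ι] in
theorem clinching_c_t (sel : SelectionRule ι κ) (M : Market ι κ) (B : ι → ℝ≥0∞) (v' : ι → ℝ)
    (order : List ι) (s : AuctionState ι κ) :
    (clinching sel M B v' order s).c = s.c ∧ (clinching sel M B v' order s).t = s.t :=
  clinching_induction (P := fun s' => s'.c = s.c ∧ s'.t = s.t) (fun _ _ h => h) order s ⟨rfl, rfl⟩

omit [DecidableEq κ] [Fintype ι] in
theorem step_t (ε : ℝ) (sel : SelectionRule ι κ) (M : Market ι κ) (B : ι → ℝ≥0∞) (v' : ι → ℝ)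
    (order : List ι) (s : AuctionState ι κ) : (step ε sel M B v' order s).t = s.t + 1 := by
  unfold step
  dsimp only
  split <;> rfl

omit [DecidableEq κ] [Fintype ι] in
/-- The price clocks are determined by the number of iterations. -/
theorem iterate_step_clock (ε : ℝ) (sel : SelectionRule ι κ) (M : Market ι κ) (B : ι → ℝ≥0∞)
    (v' : ι → ℝ) {order : List ι} (hnd : order.Nodup) {k : ℕ} (hk : k < order.length) (T : ℕ) :
    ((step ε sel M B v' order)^[T] init).t = T ∧
    ((step ε sel M B v' order)^[T] init).c order[k] =
      ε * ((T + (order.length - 1 - k)) / order.length : ℕ) := by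
  induction T with
  | zero =>
    refine ⟨rfl, ?_⟩
    -- The offset `L - 1 - k` is below the length `L`, so the quotient starts at zero and first
    -- jumps after iteration `k`.
    rw [Nat.div_eq_of_lt (by omega)]
    simp [init]
  | succ T ih =>
    obtain ⟨iht, ihc⟩ := ih
    rw [Function.iterate_succ_apply', step_t, iht]
    refine ⟨rfl, ?_⟩
    generalize (step ε sel M B v' order)^[T] init = s at *
    have hmod : T % order.length < order.length := Nat.mod_lt _ (by omega)
    have hc : (step ε sel M B v' order s).c order[k] =
        if T % order.length = k then s.c order[k] + ε else s.c order[k] := by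
      unfold step
      dsimp only
      rw [iht, List.getElem?_eq_getElem hmod]
      simp only [raisePrice, (clinching_c_t sel M B v' order s).1]
      split_ifs with h
      · simp [h]
      · rw [Function.update_of_ne fun h' => h (hnd.getElem_inj_iff.1 h').symm]
    have hdvd := dvd_add_sub_add_one_iff_mod_eq T hk
    rw [hc, ihc, show T + 1 + (order.length - 1 - k) = T + (order.length - 1 - k) + 1 by omega,
      Nat.succ_div]
    by_cases h : T % order.length = k
    · rw [if_pos h, if_pos (hdvd.2 h)]
      push_cast
      ring
    · rw [if_neg h, if_neg (mt hdvd.1 h), add_zero]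

/-! ### Coupling of two runs that differ in one bid -/

/-- The gain of buyer `i` with valuation `v`. -/
def gain (s : AuctionState ι κ) (i : ι) (v : ℝ) : ℝ := v * ∑ j, s.w i j - s.p i

omit [DecidableEq κ] [Fintype ι] in
theorem gain_clinchOne (sel : SelectionRule ι κ) (M : Market ι κ) (B : ι → ℝ≥0∞) (v' : ι → ℝ)
    (s : AuctionState ι κ) (i : ι) (v : ℝ) :
    (clinchOne sel M B v' s i).gain i v = s.gain i v + (v - s.c i) * ∑ j, sel M B s i j := by
  simp only [gain, clinchOne, Function.update_self, Pi.add_apply, Finset.sum_add_distrib]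
  ring

omit [DecidableEq κ] [Fintype ι] in
theorem gain_clinchOne_of_ne (sel : SelectionRule ι κ) (M : Market ι κ) (B : ι → ℝ≥0∞)
    (v' : ι → ℝ) (s : AuctionState ι κ) {i k : ι} (h : i ≠ k) (v : ℝ) :
    (clinchOne sel M B v' s k).gain i v = s.gain i v := by
  simp [gain, clinchOne, h]

/-- Two runs of the auction whose bids differ for buyer `i` only, who bids less in the first one:
the runs agree until the clock of `i` reaches the lower bid, and a buyer whose valuation is one of
the two bids prefers the run in which she bids it. -/
structure Coupled (M : Market ι κ) (B : ι → ℝ≥0∞) (a b : ι → ℝ) (i : ι)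
    (s s' : AuctionState ι κ) : Prop where
  left : Consistent M B a s
  right : Consistent M B b s'
  t_eq : s.t = s'.t
  c_eq : s.c i = s'.c i
  eq_of_lt : s.c i < a i → s = s'
  gain_low : s'.gain i (a i) ≤ s.gain i (a i)
  gain_high : s.gain i (b i) ≤ s'.gain i (b i)

section Coupled

variable {sel : SelectionRule ι κ} {M : Market ι κ} {B : ι → ℝ≥0∞} {a b : ι → ℝ} {i : ι}
  {s s' : AuctionState ι κ}

/-- Below the lower bid both runs make the same choice and compute the same demand. Above it the
states may differ arbitrarily for the other buyers, but only purchases of `i` affect her gain. -/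
theorem Coupled.clinchOne (hsel : sel.PicksMaximal) (hab : ∀ k ≠ i, a k = b k)
    (hi : a i ≤ b i) (h : Coupled M B a b i s s') (k : ι) :
    Coupled M B a b i (clinchOne sel M B a s k) (clinchOne sel M B b s' k) := by
  have heq : s.c i < a i → AuctionState.clinchOne sel M B a s k =
      AuctionState.clinchOne sel M B b s' k := by
    intro hlt
    obtain rfl := h.eq_of_lt hlt
    simp only [AuctionState.clinchOne]
    by_cases hk : k = i
    · subst hk
      rw [demand_congr hlt (hlt.trans_le hi)]
    · rw [hab k hk]
  refine ⟨h.left.clinchOne hsel k, h.right.clinchOne hsel k, h.t_eq, h.c_eq, heq, ?_, ?_⟩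
  all_goals
    rcases lt_or_ge (s.c i) (a i) with hlt | hge
    · rw [heq hlt]
    by_cases hk : i = k
    swap
    · rw [gain_clinchOne_of_ne _ _ _ _ _ hk, gain_clinchOne_of_ne _ _ _ _ _ hk]
      first | exact h.gain_low | exact h.gain_high
    subst hk
    -- The low run no longer sells to `i`; the high run changes her gain by `(v - c) * ∑ ξ` with `c
    -- ≥ a i`.
    rw [gain_clinchOne, gain_clinchOne, h.left.sel_eq_zero hsel hge]
    have hξ : 0 ≤ ∑ j, sel M B s' i j :=
      Finset.sum_nonneg fun j _ => (sel_mem hsel h.right.mem B i).1 j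
    rw [← h.c_eq]
    simp only [Pi.zero_apply, Finset.sum_const_zero, mul_zero, add_zero]
  · nlinarith [h.gain_low]
  · rcases lt_or_ge (s.c i) (b i) with hlt | hge'
    · nlinarith [h.gain_high]
    · rw [h.c_eq] at hge'
      rw [h.right.sel_eq_zero hsel hge']
      simpa using h.gain_high

theorem Coupled.clinching (hsel : sel.PicksMaximal) (hab : ∀ k ≠ i, a k = b k)
    (hi : a i ≤ b i) (order : List ι) (h : Coupled M B a b i s s') :
    Coupled M B a b i (clinching sel M B a order s) (clinching sel M B b order s') := by
  induction order generalizing s s' with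
  | nil => exact h
  | cons k order ih => exact ih (h.clinchOne hsel hab hi k)

theorem Coupled.raisePrice {ε : ℝ} (hε : 0 ≤ ε) (hab : ∀ k ≠ i, a k = b k)
    (hi : a i ≤ b i) (h : Coupled M B a b i s s') (l : ι) :
    Coupled M B a b i (raisePrice ε B a s l) (raisePrice ε B b s' l) := by
  refine ⟨h.left.raisePrice hε l, h.right.raisePrice hε l, h.t_eq, ?_, fun hlt => ?_,
    h.gain_low, h.gain_high⟩
  · by_cases hl : i = l
    · subst hl; simp [AuctionState.raisePrice, h.c_eq]
    · simp [AuctionState.raisePrice, hl, h.c_eq]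
  · by_cases hl : l = i
    · subst hl
      simp only [AuctionState.raisePrice, Function.update_self] at hlt
      -- The raised clock is still below `a i`, hence so was the clock before.
      obtain rfl := h.eq_of_lt (by linarith)
      simp only [AuctionState.raisePrice]
      rw [demand_congr hlt (hlt.trans_le hi)]
    · simp only [AuctionState.raisePrice, Function.update_of_ne (Ne.symm hl)] at hlt
      obtain rfl := h.eq_of_lt hlt
      simp only [AuctionState.raisePrice]
      rw [hab l hl]

theorem Coupled.setTime (h : Coupled M B a b i s s') (t : ℕ) :
    Coupled M B a b i { s with t := t } { s' with t := t } :=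
  ⟨⟨h.1.1, h.1.2, h.1.3, h.1.4, h.1.5⟩, ⟨h.2.1, h.2.2, h.2.3, h.2.4, h.2.5⟩, rfl, h.c_eq,
    fun hlt => by rw [h.eq_of_lt hlt], h.gain_low, h.gain_high⟩

theorem Coupled.step {ε : ℝ} (hε : 0 ≤ ε) (hsel : sel.PicksMaximal) (hab : ∀ k ≠ i, a k = b k)
    (hi : a i ≤ b i) (order : List ι) (h : Coupled M B a b i s s') :
    Coupled M B a b i (step ε sel M B a order s) (step ε sel M B b order s') := by
  have hc := h.clinching hsel hab hi order
  unfold AuctionState.step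
  dsimp only
  rw [← h.t_eq]
  split
  · exact (hc.raisePrice hε hab hi _).setTime _
  · exact hc.setTime _

theorem Coupled.iterate {ε : ℝ} (hε : 0 ≤ ε) (hsel : sel.PicksMaximal)
    (hab : ∀ k ≠ i, a k = b k) (hi : a i ≤ b i) (order : List ι) (h : Coupled M B a b i s s')
    (T : ℕ) : Coupled M B a b i ((AuctionState.step ε sel M B a order)^[T] s)
      ((AuctionState.step ε sel M B b order)^[T] s') := by
  induction T with
  | zero => exact h
  | succ T ih =>
    rw [Function.iterate_succ_apply', Function.iterate_succ_apply']
    exact ih.step hε hsel hab hi order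

/-- The gain of a buyer who bids her valuation does not decrease. -/
theorem Consistent.gain_clinchOne_le (hsel : sel.PicksMaximal) (hs : Consistent M B a s) (k : ι) :
    s.gain i (a i) ≤ (AuctionState.clinchOne sel M B a s k).gain i (a i) := by
  by_cases hk : i = k
  swap
  · rw [gain_clinchOne_of_ne _ _ _ _ _ hk]
  subst hk
  rw [gain_clinchOne]
  have hξ : 0 ≤ ∑ j, sel M B s i j :=
    Finset.sum_nonneg fun j _ => (sel_mem hsel hs.mem B i).1 j
  rcases lt_or_ge (s.c i) (a i) with hlt | hge
  · nlinarith
  · simp [hs.sel_eq_zero hsel hge]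

theorem Consistent.gain_iterate_nonneg {ε : ℝ} (hε : 0 ≤ ε) (hsel : sel.PicksMaximal)
    (order : List ι) (hs : Consistent M B a s) (h0 : 0 ≤ s.gain i (a i)) (T : ℕ) :
    0 ≤ ((AuctionState.step ε sel M B a order)^[T] s).gain i (a i) := by
  induction T with
  | zero => exact h0
  | succ T ih =>
    rw [Function.iterate_succ_apply']
    refine (step_induction (P := fun s => Consistent M B a s ∧ 0 ≤ s.gain i (a i)) ?_ ?_ ?_ order _
      ⟨hs.iterate hε hsel order T, ih⟩).2
    · exact fun s k h => ⟨h.1.clinchOne hsel k, h.2.trans (h.1.gain_clinchOne_le hsel k)⟩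
    · exact fun s l h => ⟨h.1.raisePrice hε l, h.2⟩
    · exact fun s t h => ⟨⟨h.1.1, h.1.2, h.1.3, h.1.4, h.1.5⟩, h.2⟩

end Coupled

end AuctionState

/-! ### Restricted markets and virtual buyers -/

namespace Market

variable {ι κ : Type} [Fintype ι] [DecidableEq ι] [DecidableEq κ]

theorem IsMonotoneSubmodular.restrict {M : Market ι κ} (h : M.IsMonotoneSubmodular)
    (S : Finset κ) : (M.restrict S).IsMonotoneSubmodular := by
  intro j
  have : (M.restrict S).nbrs j = M.nbrs j := by ext i; simp [mem_nbrs, Market.restrict]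
  rw [this]
  exact h j

/-- A transaction vector stays feasible when sellers without transactions are put back. -/
theorem extend_mem_polymatroid {M : Market ι κ} (hM : M.IsMonotoneSubmodular) {S : Finset κ}
    {w : ι → S → ℝ} (hw : w ∈ (M.restrict S).polymatroid) :
    (fun i j => if h : j ∈ S then w i ⟨j, h⟩ else 0) ∈ M.polymatroid := by
  refine ⟨⟨fun i j => ?_, fun i j hE => ?_⟩, fun j F hF => ?_⟩
  · dsimp only
    split_ifs
    exacts [hw.1.1 _ _, le_rfl]
  · dsimp only
    split_ifs
    exacts [hw.1.2 _ _ (by simpa [Market.restrict] using hE), rfl]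
  · by_cases h : j ∈ S
    · simp only [h, dite_true]
      refine hw.2 ⟨j, h⟩ F fun i hi => ?_
      simpa [mem_nbrs, Market.restrict] using mem_nbrs.1 (hF hi)
    · simpa [h] using hM.nonneg hF

variable [Fintype κ]

theorem inl_mem_addVirtual {M : Market ι κ} {i : ι} {j : κ} :
    (Sum.inl i, j) ∈ M.addVirtual.E ↔ (i, j) ∈ M.E := by
  simp [addVirtual]

theorem inr_mem_addVirtual {M : Market ι κ} {l j : κ} :
    (Sum.inr l, j) ∈ M.addVirtual.E ↔ l = j := by
  simp [addVirtual]

theorem toLeft_subset_nbrs {M : Market ι κ} {j : κ} {F : Finset (ι ⊕ κ)}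
    (hF : F ⊆ M.addVirtual.nbrs j) : F.toLeft ⊆ M.nbrs j := fun _ hi =>
  mem_nbrs.2 (inl_mem_addVirtual.1 (mem_nbrs.1 (hF (Finset.mem_toLeft.1 hi))))

theorem IsMonotoneSubmodular.addVirtual_nonneg {M : Market ι κ} (h : M.IsMonotoneSubmodular)
    (j : κ) (F : Finset (ι ⊕ κ)) (hF : F ⊆ M.addVirtual.nbrs j) : 0 ≤ M.addVirtual.f j F := by
  simp only [addVirtual]
  split_ifs
  · exact h.nonneg subset_rfl
  · exact h.nonneg (toLeft_subset_nbrs hF)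

/-- Supplies the saturation hypothesis of `eq_zero_of_insatiable` for the virtual buyer. -/
theorem addVirtual_f_of_mem {M : Market ι κ} {j : κ} {F : Finset (ι ⊕ κ)}
    (h : Sum.inr j ∈ F) : M.addVirtual.f j F = M.addVirtual.f j (M.addVirtual.nbrs j) := by
  have hj : Sum.inr j ∈ M.addVirtual.nbrs j := mem_nbrs.2 (inr_mem_addVirtual.2 rfl)
  exact (if_pos h).trans (if_pos hj).symm

/-- Cancelling the transactions of the virtual buyers keeps an allocation feasible. -/
theorem inl_mem_polymatroid {M : Market ι κ} {w : ι ⊕ κ → κ → ℝ}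
    (hw : w ∈ M.addVirtual.polymatroid) : (fun i => w (Sum.inl i)) ∈ M.polymatroid := by
  refine ⟨⟨fun i j => hw.1.1 _ j, fun i j h => hw.1.2 _ j (mt inl_mem_addVirtual.1 h)⟩,
    fun j F hF => ?_⟩
  have h := hw.2 j (F.map Function.Embedding.inl) fun i hi => by
    obtain ⟨i, hiF, rfl⟩ := Finset.mem_map.1 hi
    exact mem_nbrs.2 (inl_mem_addVirtual.2 (mem_nbrs.1 (hF hiF)))
  have hleft : (F.map (Function.Embedding.inl : ι ↪ ι ⊕ κ)).toLeft = F := by ext; simp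
  simpa [addVirtual, hleft] using h

end Market

/-! ### The Polyhedral Clinching Auction -/

namespace PCA

variable {n : ℕ} {κ : Type} [Fintype κ] [LinearOrder κ]

theorem nodup_order (n : ℕ) (κ : Type) [Fintype κ] [LinearOrder κ] : (order n κ).Nodup := by
  refine List.Nodup.append ((List.nodup_finRange n).map Sum.inl_injective)
    ((Finset.sort_nodup _ _).map Sum.inr_injective) ?_
  intro x hx hy
  obtain ⟨i, -, rfl⟩ := List.mem_map.1 hx
  obtain ⟨j, -, h⟩ := List.mem_map.1 hy
  cases h

theorem mem_order (l : Fin n ⊕ κ) : l ∈ order n κ := by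
  cases l <;> simp [order]

theorem exists_getElem_order_inl (i : Fin n) :
    ∃ k < n, ∃ hk : k < (order n κ).length, (order n κ)[k] = Sum.inl i :=
  ⟨i, i.2, by simp [order]; omega, by simp [order]⟩

theorem exists_getElem_order_inr (n : ℕ) (j : κ) :
    ∃ k ≥ n, ∃ hk : k < (order n κ).length, (order n κ)[k] = Sum.inr j := by
  obtain ⟨k, hk, h⟩ := List.mem_iff_getElem.1
    ((Finset.mem_sort (· ≤ ·) (s := (Finset.univ : Finset κ))).2 (Finset.mem_univ j))
  refine ⟨n + k, Nat.le_add_right _ _, ?_, ?_⟩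
  · simpa [order] using hk
  · simp [order, h]

variable {ε : ℝ} {sel : SelectionRule (Fin n ⊕ κ) κ} {M : Market (Fin n) κ}
  {v' : Fin n → ℝ} {ρ' : κ → ℝ} {B : Fin n → ℝ≥0∞}

theorem stateAt_clock (T : ℕ) {k : ℕ} (hk : k < (order n κ).length) :
    (stateAt ε sel M v' ρ' B T).c (order n κ)[k] =
      ε * ((T + ((order n κ).length - 1 - k)) / (order n κ).length : ℕ) :=
  (AuctionState.iterate_step_clock ε sel _ _ _ (nodup_order n κ) hk T).2

/-- Original buyers precede virtual ones in the cyclic order, so within each round their clocks rise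
first. -/
theorem stateAt_clock_inr_le (hε : 0 ≤ ε) (T : ℕ) (i : Fin n) (j : κ) :
    (stateAt ε sel M v' ρ' B T).c (Sum.inr j) ≤ (stateAt ε sel M v' ρ' B T).c (Sum.inl i) := by
  obtain ⟨k, hkn, hk, hki⟩ := exists_getElem_order_inl (κ := κ) i
  obtain ⟨k', hkn', hk', hkj⟩ := exists_getElem_order_inr n j
  rw [← hki, ← hkj, stateAt_clock, stateAt_clock]
  have : k ≤ k' := by omega
  gcongr

theorem consistent_init (hM : M.IsMonotoneSubmodular) (hv : ∀ i, 0 < v' i) (hρ : ∀ j, 0 < ρ' j) :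
    AuctionState.Consistent M.addVirtual (Sum.elim B fun _ => ⊤) (Sum.elim v' ρ')
      AuctionState.init :=
  .init hM.addVirtual_nonneg _ (by rintro (i | j); exacts [hv i, hρ j])

theorem consistent_stateAt (hε : 0 ≤ ε) (hsel : sel.PicksMaximal) (hM : M.IsMonotoneSubmodular)
    (hv : ∀ i, 0 < v' i) (hρ : ∀ j, 0 < ρ' j) (T : ℕ) :
    AuctionState.Consistent M.addVirtual (Sum.elim B fun _ => ⊤) (Sum.elim v' ρ')
      (stateAt ε sel M v' ρ' B T) :=
  (consistent_init hM hv hρ).iterate hε hsel _ T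

theorem terminates (hε : 0 < ε) (hsel : sel.PicksMaximal) (hM : M.IsMonotoneSubmodular)
    (hv : ∀ i, 0 < v' i) (hρ : ∀ j, 0 < ρ' j) : Terminates ε sel M v' ρ' B := by
  obtain ⟨K, hK⟩ : ∃ K : ℕ, ∀ l : Fin n ⊕ κ, Sum.elim v' ρ' l ≤ ε * K := by
    obtain ⟨C, hC⟩ := (Set.finite_range (Sum.elim v' ρ')).bddAbove
    obtain ⟨K, hK⟩ := exists_nat_ge (C / ε)
    refine ⟨K, fun l => (hC ⟨l, rfl⟩).trans ?_⟩
    rwa [div_le_iff₀' hε] at hK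
  -- After `K` full rounds each clock is at least `ε * K`, which dominates all bids.
  refine ⟨(order n κ).length * K, fun l => ?_⟩
  rw [(consistent_stateAt hε.le hsel hM hv hρ _).d_eq l]
  refine demand_eq_zero ((hK l).trans ?_)
  obtain ⟨k, hk, rfl⟩ := List.mem_iff_getElem.1 (mem_order l)
  rw [stateAt_clock]
  have : 0 < (order n κ).length := by omega
  rw [Nat.mul_add_div this]
  gcongr
  exact Nat.le_add_right _ _

/-- The outcome may be read off after any sufficiently large number of iterations. -/
theorem exists_run_eq_stateAt (hε : 0 < ε) (hsel : sel.PicksMaximal)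
    (hM : M.IsMonotoneSubmodular) (hv : ∀ i, 0 < v' i) (hρ : ∀ j, 0 < ρ' j) :
    ∃ T₀, ∀ T ≥ T₀, (run ε sel M v' ρ' B).w = (fun i => (stateAt ε sel M v' ρ' B T).w (.inl i)) ∧
      (run ε sel M v' ρ' B).p = (fun i => (stateAt ε sel M v' ρ' B T).p (.inl i)) := by
  refine ⟨sInf {T | (stateAt ε sel M v' ρ' B T).Halted}, fun T hT => ?_⟩
  have hh : (stateAt ε sel M v' ρ' B (sInf {T | (stateAt ε sel M v' ρ' B T).Halted})).Halted :=
    Nat.sInf_mem (s := {T | (stateAt ε sel M v' ρ' B T).Halted}) (terminates hε hsel hM hv hρ)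
  have h := (consistent_stateAt hε.le hsel hM hv hρ _).iterate_of_halted hε.le hsel (order n κ) hh
    (T - sInf {T | (stateAt ε sel M v' ρ' B T).Halted})
  rw [stateAt, ← Function.iterate_add_apply, Nat.sub_add_cancel hT] at h
  simp only [run, finalState, stateAt] at h ⊢
  rw [h.2.1, h.2.2]
  exact ⟨rfl, rfl⟩

theorem run_mem_polymatroid (hε : 0 < ε) (hsel : sel.PicksMaximal) (hM : M.IsMonotoneSubmodular)
    (hv : ∀ i, 0 < v' i) (hρ : ∀ j, 0 < ρ' j) : (run ε sel M v' ρ' B).w ∈ M.polymatroid :=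
  Market.inl_mem_polymatroid (consistent_stateAt hε.le hsel hM hv hρ _).mem

theorem run_p_nonneg (hε : 0 < ε) (hsel : sel.PicksMaximal) (hM : M.IsMonotoneSubmodular)
    (hv : ∀ i, 0 < v' i) (hρ : ∀ j, 0 < ρ' j) (i : Fin n) : 0 ≤ (run ε sel M v' ρ' B).p i :=
  (consistent_stateAt hε.le hsel hM hv hρ _).p_nonneg _

theorem run_p_le (hε : 0 < ε) (hsel : sel.PicksMaximal) (hM : M.IsMonotoneSubmodular)
    (hv : ∀ i, 0 < v' i) (hρ : ∀ j, 0 < ρ' j) (i : Fin n) :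
    ENNReal.ofReal ((run ε sel M v' ρ' B).p i) ≤ B i :=
  (consistent_stateAt hε.le hsel hM hv hρ _).p_le (.inl i)

/-- A buyer clinches from a seller only at prices at or above the bid of the seller. -/
theorem sel_eq_zero_of_clock_lt (hsel : sel.PicksMaximal)
    {s : AuctionState (Fin n ⊕ κ) κ} (hs : AuctionState.Consistent M.addVirtual
      (Sum.elim B fun _ => ⊤) (Sum.elim v' ρ') s) (i : Fin n) (j : κ)
    (hj : s.c (Sum.inr j) < ρ' j) :
    sel M.addVirtual (Sum.elim B fun _ => ⊤) s (Sum.inl i) j = 0 :=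
  Market.eq_zero_of_insatiable hs.mem (AuctionState.sel_mem hsel hs.mem _ _) (l := Sum.inr j)
    (by simp) (Market.inr_mem_addVirtual.2 rfl)
    (fun _ h => (Market.inr_mem_addVirtual.1 h).symm)
    (fun _ _ h => Market.addVirtual_f_of_mem h) ((hs.d_eq _).trans (demand_top hj))

/-- A purchase from `j` requires the virtual clock of `j` to have reached `ρ' j`, and the clock of
buyer `i` is at least as high. -/
theorem sum_bid_mul_le_stateAt_p (hε : 0 ≤ ε) (hsel : sel.PicksMaximal)
    (hM : M.IsMonotoneSubmodular) (hv : ∀ i, 0 < v' i) (hρ : ∀ j, 0 < ρ' j) (i : Fin n) (T : ℕ) :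
    ∑ j, ρ' j * (stateAt ε sel M v' ρ' B T).w (Sum.inl i) j ≤
      (stateAt ε sel M v' ρ' B T).p (Sum.inl i) := by
  induction T with
  | zero => simp [stateAt, AuctionState.init]
  | succ T ih =>
    have hclock := stateAt_clock_inr_le (sel := sel) (M := M) (v' := v') (ρ' := ρ') (B := B) hε T i
    have hcons := consistent_stateAt (B := B) hε hsel hM hv hρ T
    rw [stateAt, Function.iterate_succ_apply']
    change _ ≤ (AuctionState.step ε sel M.addVirtual _ _ _ (stateAt ε sel M v' ρ' B T)).p _
    change ∑ j, ρ' j *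
      (AuctionState.step ε sel M.addVirtual _ _ _ (stateAt ε sel M v' ρ' B T)).w _ j ≤ _
    generalize stateAt ε sel M v' ρ' B T = s at *
    -- The clock comparison is carried only through the clinching phase, where clocks stand still;
    -- for each new iteration it comes from the closed formula. Raising a price affects neither `w`
    -- nor `p`.
    let P : AuctionState (Fin n ⊕ κ) κ → Prop := fun s =>
      AuctionState.Consistent M.addVirtual (Sum.elim B fun _ => ⊤) (Sum.elim v' ρ') s ∧
        (∀ j, s.c (Sum.inr j) ≤ s.c (Sum.inl i)) ∧
        ∑ j, ρ' j * s.w (Sum.inl i) j ≤ s.p (Sum.inl i)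
    have hP : ∀ s k, P s →
        P (s.clinchOne sel M.addVirtual (Sum.elim B fun _ => ⊤) (Sum.elim v' ρ') k) := by
      rintro s k ⟨hs, hc, hle⟩
      refine ⟨hs.clinchOne hsel k, hc, ?_⟩
      by_cases hk : Sum.inl i = k
      swap
      · simpa [AuctionState.clinchOne, hk] using hle
      subst hk
      simp only [AuctionState.clinchOne, Function.update_self, Pi.add_apply, mul_add,
        Finset.sum_add_distrib, Finset.mul_sum]
      refine add_le_add hle (Finset.sum_le_sum fun j _ => ?_)
      rcases lt_or_ge (s.c (Sum.inr j)) (ρ' j) with hlt | hge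
      · simp [sel_eq_zero_of_clock_lt hsel hs i j hlt]
      · exact mul_le_mul_of_nonneg_right (hge.trans (hc j))
          ((AuctionState.sel_mem hsel hs.mem _ _).1 j)
    have h := (AuctionState.clinching_induction hP (order n κ) s ⟨hcons, hclock, ih⟩).2.2
    unfold AuctionState.step
    dsimp only
    split <;> exact h

theorem sum_bid_mul_le_run_p (hε : 0 < ε) (hsel : sel.PicksMaximal) (hM : M.IsMonotoneSubmodular)
    (hv : ∀ i, 0 < v' i) (hρ : ∀ j, 0 < ρ' j) (i : Fin n) :
    ∑ j, ρ' j * (run ε sel M v' ρ' B).w i j ≤ (run ε sel M v' ρ' B).p i :=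
  sum_bid_mul_le_stateAt_p hε.le hsel hM hv hρ i _

/-- Bidding the valuation is optimal for a buyer. -/
theorem run_gain_le (hε : 0 < ε) (hsel : sel.PicksMaximal) (hM : M.IsMonotoneSubmodular)
    (hv : ∀ i, 0 < v' i) (hρ : ∀ j, 0 < ρ' j) (i : Fin n) {v : ℝ} (hv0 : 0 < v) :
    v * ∑ j, (run ε sel M v' ρ' B).w i j - (run ε sel M v' ρ' B).p i ≤
      v * ∑ j, (run ε sel M (Function.update v' i v) ρ' B).w i j -
        (run ε sel M (Function.update v' i v) ρ' B).p i := by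
  have hv2 : ∀ k, 0 < Function.update v' i v k := by
    intro k
    by_cases hk : k = i
    · subst hk; simpa using hv0
    · simpa [hk] using hv k
  obtain ⟨T₁, h₁⟩ := exists_run_eq_stateAt (B := B) hε hsel hM hv hρ
  obtain ⟨T₂, h₂⟩ := exists_run_eq_stateAt (B := B) hε hsel hM hv2 hρ
  obtain ⟨hw₁, hp₁⟩ := h₁ (max T₁ T₂) (le_max_left _ _)
  obtain ⟨hw₂, hp₂⟩ := h₂ (max T₁ T₂) (le_max_right _ _)
  rw [hw₁, hp₁, hw₂, hp₂]
  have hab : ∀ k ≠ (Sum.inl i : Fin n ⊕ κ),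
      Sum.elim v' ρ' k = Sum.elim (Function.update v' i v) ρ' k := by
    rintro (k | k) hk
    · have : k ≠ i := fun h => hk (by rw [h])
      simp [this]
    · rfl
  have c₁ := consistent_init (B := B) hM hv hρ
  have c₂ := consistent_init (B := B) hM hv2 hρ
  -- The valuation `v` acts as the higher bid of the coupling if `v' i ≤ v`, and as the lower one
  -- otherwise.
  rcases le_total (v' i) v with hle | hle
  · have h := (AuctionState.Coupled.iterate (i := Sum.inl i) hε.le hsel hab (by simpa using hle)
      (order n κ) ⟨c₁, c₂, rfl, rfl, fun _ => rfl, le_rfl, le_rfl⟩ (max T₁ T₂)).gain_high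
    simp only [Sum.elim_inl, Function.update_self] at h
    exact h
  · have h := (AuctionState.Coupled.iterate (i := Sum.inl i) hε.le hsel
      (fun k hk => (hab k hk).symm) (by simpa using hle)
      (order n κ) ⟨c₂, c₁, rfl, rfl, fun _ => rfl, le_rfl, le_rfl⟩ (max T₁ T₂)).gain_low
    simp only [Sum.elim_inl, Function.update_self] at h
    exact h

theorem run_gain_nonneg (hε : 0 < ε) (hsel : sel.PicksMaximal) (hM : M.IsMonotoneSubmodular)
    (hv : ∀ i, 0 < v' i) (hρ : ∀ j, 0 < ρ' j) (i : Fin n) :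
    0 ≤ v' i * ∑ j, (run ε sel M v' ρ' B).w i j - (run ε sel M v' ρ' B).p i :=
  (consistent_init hM hv hρ).gain_iterate_nonneg (i := Sum.inl i) hε.le hsel (order n κ)
    (by simp [AuctionState.gain, AuctionState.init]) _

end PCA

/-! ### Changing one bid -/

namespace Info

variable {n m : ℕ} {I : Info n m}

theorem Valid.restrict (hI : I.Valid) :
    (I.market.restrict (participants I)).IsMonotoneSubmodular := hI.1.restrict _

theorem Valid.setBuyerBid (hI : I.Valid) (i : Fin n) {v : ℝ} (hv : 0 < v) :
    (I.setBuyerBid i v).Valid := by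
  refine ⟨hI.1, fun k => ?_, hI.2.2.1, hI.2.2.2⟩
  by_cases hk : k = i
  · subst hk; simpa [Info.setBuyerBid] using hv
  · simpa [Info.setBuyerBid, hk] using hI.2.1 k

theorem Valid.setSellerBid (hI : I.Valid) (j : Fin m) {ρ : ℝ} (hρ : 0 < ρ) :
    (I.setSellerBid j ρ).Valid := by
  refine ⟨hI.1, hI.2.1, fun k => ?_, hI.2.2.2⟩
  by_cases hk : k = j
  · subst hk; simpa [Info.setSellerBid] using hρ
  · simpa [Info.setSellerBid, hk] using hI.2.2.1 k

theorem mem_participants {j : Fin m} : j ∈ participants I ↔ I.ρ' j ≤ I.ρs j := by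
  simp [participants]

theorem participants_setSellerBid {j : Fin m} {ρ : ℝ} (h : I.ρ' j ≤ I.ρs j ↔ ρ ≤ I.ρs j) :
    participants (I.setSellerBid j ρ) = participants I := by
  ext k
  rw [mem_participants, mem_participants]
  by_cases hk : k = j
  · subst hk; simpa [Info.setSellerBid] using h.symm
  · simp [Info.setSellerBid, hk]

end Info

/-! ### The single-sample mechanism -/

section SingleSample

variable {n m : ℕ} {ε : ℝ} {sel : (S : Finset (Fin m)) → SelectionRule (Fin n ⊕ S) S}
  {I : Info n m}

theorem singleSampleMechanism_r (I : Info n m) (j : Fin m) :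
    (singleSampleMechanism ε sel I).r j =
      I.ρs j * ∑ i, (singleSampleMechanism ε sel I).w i j := by
  by_cases h : j ∈ participants I <;> simp [singleSampleMechanism, h]

theorem singleSampleMechanism_w_of_notMem {j : Fin m} (h : j ∉ participants I) (i : Fin n) :
    (singleSampleMechanism ε sel I).w i j = 0 := by
  simp [singleSampleMechanism, h]

/-- The weight `g` is `1` for buyer utilities and `ρs` for budget balance. -/
theorem sum_singleSampleMechanism_w (g : Fin m → ℝ) (i : Fin n) :
    ∑ j, g j * (singleSampleMechanism ε sel I).w i j = ∑ j : participants I, g j *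
      (PCA.run ε (sel (participants I)) (I.market.restrict (participants I)) I.v'
        (fun j : participants I => I.ρs j) I.B).w i j := by
  rw [← Finset.sum_subset (Finset.subset_univ (participants I)) fun j _ hj => by
    rw [singleSampleMechanism_w_of_notMem hj, mul_zero],
    ← Finset.sum_coe_sort (participants I)]
  exact Finset.sum_congr rfl fun j _ => by simp [singleSampleMechanism]

theorem singleSampleMechanism_w_mem (hε : 0 < ε) (hsel : ∀ S, (sel S).PicksMaximal)
    (hI : I.Valid) : (singleSampleMechanism ε sel I).w ∈ I.market.polymatroid :=
  Market.extend_mem_polymatroid hI.1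
    (PCA.run_mem_polymatroid hε (hsel _) hI.restrict hI.2.1 fun j => hI.2.2.2 j)

theorem buyerUtility_singleSampleMechanism (hε : 0 < ε) (hsel : ∀ S, (sel S).PicksMaximal)
    (hI : I.Valid) (i : Fin n) (v : ℝ) :
    buyerUtility I (singleSampleMechanism ε sel I) i v =
      ((v * ∑ j, (PCA.run ε (sel (participants I)) (I.market.restrict (participants I)) I.v'
          (fun j : participants I => I.ρs j) I.B).w i j -
        (PCA.run ε (sel (participants I)) (I.market.restrict (participants I)) I.v'
          (fun j : participants I => I.ρs j) I.B).p i : ℝ) : EReal) := by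
  have h := sum_singleSampleMechanism_w (ε := ε) (sel := sel) (I := I) (fun _ => 1) i
  simp only [one_mul] at h
  rw [buyerUtility, h]
  exact if_pos (PCA.run_p_le hε (hsel _) hI.restrict hI.2.1 (fun j => hI.2.2.2 j) i)

theorem sellerUtility_singleSampleMechanism (hε : 0 < ε) (hsel : ∀ S, (sel S).PicksMaximal)
    (hI : I.Valid) (j : Fin m) (ρ : ℝ) :
    sellerUtility I (singleSampleMechanism ε sel I) j ρ =
      (I.ρs j - ρ) * ∑ i, (singleSampleMechanism ε sel I).w i j := by
  have h : ∑ i ∈ I.market.nbrs j, (singleSampleMechanism ε sel I).w i j =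
      ∑ i, (singleSampleMechanism ε sel I).w i j :=
    Finset.sum_subset (Finset.subset_univ _) fun i _ hi =>
      (singleSampleMechanism_w_mem hε hsel hI).1.2 i j (mt Market.mem_nbrs.2 hi)
  rw [sellerUtility, unsold, singleSampleMechanism_r, h]
  ring

theorem sum_singleSampleMechanism_w_nonneg (hε : 0 < ε) (hsel : ∀ S, (sel S).PicksMaximal)
    (hI : I.Valid) (j : Fin m) : 0 ≤ ∑ i, (singleSampleMechanism ε sel I).w i j :=
  Finset.sum_nonneg fun i _ => (singleSampleMechanism_w_mem hε hsel hI).1.1 i j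

theorem singleSampleMechanism_isFeasible (hε : 0 < ε) (hsel : ∀ S, (sel S).PicksMaximal) :
    (singleSampleMechanism ε sel).IsFeasible := by
  refine fun I hI => ⟨singleSampleMechanism_w_mem hε hsel hI, fun i => ⟨?_, ?_⟩, fun j => ?_⟩
  · exact PCA.run_p_nonneg hε (hsel _) hI.restrict hI.2.1 (fun j => hI.2.2.2 j) i
  · exact PCA.run_p_le hε (hsel _) hI.restrict hI.2.1 (fun j => hI.2.2.2 j) i
  · rw [singleSampleMechanism_r]
    exact mul_nonneg (hI.2.2.2 j).le (sum_singleSampleMechanism_w_nonneg hε hsel hI j)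

theorem singleSampleMechanism_dsicForBuyers (hε : 0 < ε) (hsel : ∀ S, (sel S).PicksMaximal) :
    (singleSampleMechanism ε sel).DSICForBuyers := by
  intro I hI i v hv
  rw [buyerUtility_singleSampleMechanism hε hsel hI]
  refine le_of_le_of_eq ?_
    (buyerUtility_singleSampleMechanism hε hsel (hI.setBuyerBid i hv) i v).symm
  exact EReal.coe_le_coe_iff.2
    (PCA.run_gain_le hε (hsel _) hI.restrict hI.2.1 (fun j => hI.2.2.2 j) i hv)

theorem singleSampleMechanism_irForBuyers (hε : 0 < ε) (hsel : ∀ S, (sel S).PicksMaximal) :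
    (singleSampleMechanism ε sel).IRForBuyers := by
  intro I hI i v hv
  have hI' := hI.setBuyerBid i hv
  refine le_of_le_of_eq ?_ (buyerUtility_singleSampleMechanism hε hsel hI' i v).symm
  have h := PCA.run_gain_nonneg (B := I.B) hε (hsel _) hI'.restrict hI'.2.1
    (fun j => hI'.2.2.2 j) i
  rw [show (I.setBuyerBid i v).v' i = v from Function.update_self ..] at h
  exact EReal.coe_nonneg.2 h

theorem singleSampleMechanism_irForSellers (hε : 0 < ε) (hsel : ∀ S, (sel S).PicksMaximal) :
    (singleSampleMechanism ε sel).IRForSellers := by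
  intro I hI j ρ hρ
  have hI' := hI.setSellerBid j hρ
  refine le_of_le_of_eq ?_ (sellerUtility_singleSampleMechanism hε hsel hI' j ρ).symm
  by_cases h : j ∈ participants (I.setSellerBid j ρ)
  · refine mul_nonneg (sub_nonneg.2 ?_) (sum_singleSampleMechanism_w_nonneg hε hsel hI' j)
    simpa [Info.setSellerBid] using Info.mem_participants.1 h
  · simp [singleSampleMechanism_w_of_notMem h]

/-- The outcome of the mechanism when the participating sellers are those in `S`. -/
noncomputable def singleSampleOutcome (ε : ℝ)
    (sel : (S : Finset (Fin m)) → SelectionRule (Fin n ⊕ S) S) (I : Info n m)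
    (S : Finset (Fin m)) : Allocation (Fin n) (Fin m) :=
  let A := PCA.run ε (sel S) (I.market.restrict S) I.v' (fun j : S => I.ρs j) I.B
  { w := fun i j => if h : j ∈ S then A.w i ⟨j, h⟩ else 0
    p := A.p
    r := fun j => if h : j ∈ S then I.ρs j * ∑ i, A.w i ⟨j, h⟩ else 0 }

/-- Seller bids enter only through the set of participants. With that set as an explicit argument of
`singleSampleOutcome`, it can be rewritten although types depend on it. -/
theorem singleSampleMechanism_setSellerBid {j : Fin m} {ρ : ℝ}
    (h : I.ρ' j ≤ I.ρs j ↔ ρ ≤ I.ρs j) :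
    singleSampleMechanism ε sel (I.setSellerBid j ρ) = singleSampleMechanism ε sel I := by
  change singleSampleOutcome ε sel I (participants (I.setSellerBid j ρ)) =
    singleSampleOutcome ε sel I (participants I)
  rw [Info.participants_setSellerBid h]

theorem singleSampleMechanism_dsicForSellers (hε : 0 < ε) (hsel : ∀ S, (sel S).PicksMaximal) :
    (singleSampleMechanism ε sel).DSICForSellers := by
  intro I hI j ρ hρ
  by_cases h : I.ρ' j ≤ I.ρs j ↔ ρ ≤ I.ρs j
  · rw [singleSampleMechanism_setSellerBid h]
  -- When the two bids lead to different participation, the deviating utility is at most zero, which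
  -- truthful bidding guarantees.
  refine le_trans ?_ (singleSampleMechanism_irForSellers hε hsel I hI j ρ hρ)
  rw [sellerUtility_singleSampleMechanism hε hsel hI]
  by_cases hj : j ∈ participants I
  · rw [Info.mem_participants] at hj
    -- The bid participates and the valuation would not, so every unit is sold below valuation.
    have : I.ρs j < ρ := not_le.1 fun h' => h ⟨fun _ => h', fun _ => hj⟩
    exact mul_nonpos_of_nonpos_of_nonneg (sub_nonpos.2 this.le)
      (sum_singleSampleMechanism_w_nonneg hε hsel hI j)
  · simp [singleSampleMechanism_w_of_notMem hj]

theorem singleSampleMechanism_wbb (hε : 0 < ε) (hsel : ∀ S, (sel S).PicksMaximal) :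
    (singleSampleMechanism ε sel).WBB := by
  intro I hI
  simp only [singleSampleMechanism_r, Finset.mul_sum]
  rw [Finset.sum_comm]
  refine Finset.sum_le_sum fun i _ => ?_
  rw [sum_singleSampleMechanism_w]
  exact PCA.sum_bid_mul_le_run_p hε (hsel _) hI.restrict hI.2.1 (fun j => hI.2.2.2 j) i

end SingleSample

theorem theorem4p4 {n m : ℕ} (ε : ℝ) (hε : 0 < ε)
    (sel : (S : Finset (Fin m)) → SelectionRule (Fin n ⊕ S) S)
    (hsel : ∀ S, (sel S).PicksMaximal) :
    (∀ I : Info n m, I.Valid →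
      PCA.Terminates ε (sel (participants I)) (I.market.restrict (participants I)) I.v'
        (fun j : participants I => I.ρs j) I.B) ∧
    (singleSampleMechanism ε sel).IsFeasible ∧
    (singleSampleMechanism ε sel).DSICForBuyers ∧
    (singleSampleMechanism ε sel).DSICForSellers ∧
    (singleSampleMechanism ε sel).IRForBuyers ∧
    (singleSampleMechanism ε sel).IRForSellers ∧
    (singleSampleMechanism ε sel).WBB ∧
    (∀ I : Info n m, I.Valid → ∀ j,
      (singleSampleMechanism ε sel I).r j = I.ρs j * ∑ i, (singleSampleMechanism ε sel I).w i j) := by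
  exact ⟨fun I hI => PCA.terminates hε (hsel _) hI.restrict hI.2.1 fun j => hI.2.2.2 j,
    singleSampleMechanism_isFeasible hε hsel, singleSampleMechanism_dsicForBuyers hε hsel,
    singleSampleMechanism_dsicForSellers hε hsel, singleSampleMechanism_irForBuyers hε hsel,
    singleSampleMechanism_irForSellers hε hsel, singleSampleMechanism_wbb hε hsel,
    fun I _ j => singleSampleMechanism_r I j⟩
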